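/- Let $q$ be a prime power and let $\mathrm{AG}(3,q)$ be the affine space of dimension $3$ over the field $\mathbb{F}_q$: its points are the vectors of a $3$-dimensional vector space over $\mathbb{F}_q$, and its lines are the cosets of the $1$-dimensional linear subspaces. A \emph{line spread} of $\mathrm{AG}(3,q)$ is a set of pairwise disjoint lines that partitions the point set, where two lines are disjoint if they have no point of $\mathrm{AG}(3,q)$ in common. A \emph{Cameron–Liebler (CL) line class of parameter $x$} in $\mathrm{AG}(3,q)$ is a set $\mathcal{L}$ of lines such that $|\mathcal{L}\cap\mathcal{S}|=x$ for every line spread $\mathcal{S}$ of $\mathrm{AG}(3,q)$. Then the following hold. 1. A set $\mathcal{L}$ of lines of $\mathrm{AG}(3,q)$ is a CL line class of parameter $0$ if and only if $\mathcal{L}=\emptyset$. 2. A set $\mathcal{L}$ of lines of $\mathrm{AG}(3,q)$ is a CL line class of parameter $1$ if and only if there is a point $p$ of $\mathrm{AG}(3,q)$ such that $\mathcal{L}$ is the set of all lines of $\mathrm{AG}(3,q)$ through $p$. 3. There is no CL line class of parameter $2$ in $\mathrm{AG}(3,q)$. -/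

import Mathlib

namespace AffineCL

/-- The lines of the affine space whose points are the vectors of `V`: the nonempty affine
subspaces of dimension one, i.e. the cosets of the one-dimensional linear subspaces. -/
def lines (F V : Type*) [Field F] [AddCommGroup V] [Module F V] : Set (AffineSubspace F V) :=
  {l | (l : Set V).Nonempty ∧ Module.finrank F l.direction = 1}

/-- A partial line spread: a set of pairwise disjoint affine lines.  Disjoint means that there is
no common affine point, so distinct parallel lines are disjoint. -/
def IsPartialLineSpread {F V : Type*} [Field F] [AddCommGroup V] [Module F V]
    (S : Set (AffineSubspace F V)) : Prop :=
  S ⊆ lines F V ∧ S.Pairwise fun l m => Disjoint (l : Set V) (m : Set V)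

/-- A line spread: a partial line spread that partitions the set of affine points. -/
def IsLineSpread {F V : Type*} [Field F] [AddCommGroup V] [Module F V]
    (S : Set (AffineSubspace F V)) : Prop :=
  IsPartialLineSpread S ∧ ∀ p : V, ∃ l ∈ S, p ∈ l

/-- A Cameron-Liebler line class of parameter `x`: a set of affine lines that has exactly `x`
lines in common with every line spread. -/
def IsCLLineClass {F V : Type*} [Field F] [AddCommGroup V] [Module F V]
    (L : Set (AffineSubspace F V)) (x : ℕ) : Prop :=
  L ⊆ lines F V ∧ ∀ S : Set (AffineSubspace F V), IsLineSpread S → (L ∩ S).encard = x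

/-- The point-pencil of `p`: the set of all affine lines through the affine point `p`. -/
def pointPencil (F : Type*) {V : Type*} [Field F] [AddCommGroup V] [Module F V] (p : V) :
    Set (AffineSubspace F V) :=
  {l | l ∈ lines F V ∧ p ∈ l}

end AffineCL

namespace AffineCL

section

variable {F V : Type*} [Field F] [AddCommGroup V] [Module F V]

/-- The lines of direction `d` not contained in `π`, together with the lines of direction `e`
contained in `π`. -/
def switchedClass (d e : Submodule F V) (π : AffineSubspace F V) : Set (AffineSubspace F V) :=
  {l | l ∈ lines F V ∧ l.direction = d ∧ ¬ l ≤ π} ∪ {l | l ∈ lines F V ∧ l.direction = e ∧ l ≤ π}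

lemma mk'_mem_lines {d : Submodule F V} (hd : Module.finrank F d = 1) (p : V) :
    AffineSubspace.mk' p d ∈ lines F V :=
  ⟨⟨p, AffineSubspace.self_mem_mk' p d⟩, by rw [AffineSubspace.direction_mk', hd]⟩

lemma le_of_mem_of_direction_le {l m : AffineSubspace F V} {p : V} (hl : p ∈ l) (hm : p ∈ m)
    (h : l.direction ≤ m.direction) : l ≤ m := by
  intro q hq
  have := AffineSubspace.vadd_mem_of_mem_direction
    (h (AffineSubspace.vsub_mem_direction hq hl)) hm
  simpa using this

lemma eq_of_mem_of_direction_eq {l m : AffineSubspace F V} {p : V} (hl : p ∈ l) (hm : p ∈ m)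
    (h : l.direction = m.direction) : l = m :=
  (AffineSubspace.eq_iff_direction_eq_of_mem hl hm).2 h

lemma disjoint_of_forall_mem_eq {l m : AffineSubspace F V} (hne : l ≠ m)
    (h : ∀ p, p ∈ l → p ∈ m → l = m) : Disjoint (l : Set V) (m : Set V) :=
  Set.disjoint_left.2 fun p hl hm => hne (h p hl hm)

lemma isLineSpread_switchedClass {d e : Submodule F V} {π : AffineSubspace F V}
    (hd : Module.finrank F d = 1) (he : Module.finrank F e = 1)
    (hdπ : d ≤ π.direction) (heπ : e ≤ π.direction) : IsLineSpread (switchedClass d e π) := by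
  refine ⟨⟨?_, ?_⟩, fun p => ?_⟩
  · rintro l (hl | hl) <;> exact hl.1
  · rintro l hl m hm hne
    refine disjoint_of_forall_mem_eq hne fun p hpl hpm => ?_
    rcases hl with ⟨-, hl, hlπ⟩ | ⟨-, hl, hlπ⟩ <;> rcases hm with ⟨-, hm, hmπ⟩ | ⟨-, hm, hmπ⟩
    · exact eq_of_mem_of_direction_eq hpl hpm (hl.trans hm.symm)
    · exact absurd (le_of_mem_of_direction_le hpl (hmπ hpm) (hl.trans_le hdπ)) hlπ
    · exact absurd (le_of_mem_of_direction_le hpm (hlπ hpl) (hm.trans_le hdπ)) hmπ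
    · exact eq_of_mem_of_direction_eq hpl hpm (hl.trans hm.symm)
  · by_cases hp : p ∈ π
    · refine ⟨AffineSubspace.mk' p e, Or.inr ⟨mk'_mem_lines he p, AffineSubspace.direction_mk' _ _,
        ?_⟩, AffineSubspace.self_mem_mk' p e⟩
      exact le_of_mem_of_direction_le (AffineSubspace.self_mem_mk' p e) hp
        (by rwa [AffineSubspace.direction_mk'])
    · exact ⟨AffineSubspace.mk' p d, Or.inl ⟨mk'_mem_lines hd p, AffineSubspace.direction_mk' _ _,
        fun h => hp (h (AffineSubspace.self_mem_mk' p d))⟩, AffineSubspace.self_mem_mk' p d⟩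

namespace IsCLLineClass

variable {L : Set (AffineSubspace F V)} {x : ℕ}

lemma encard_inter_switchedClass (hL : IsCLLineClass L x) {d e : Submodule F V}
    {π : AffineSubspace F V} (hd : Module.finrank F d = 1) (he : Module.finrank F e = 1)
    (hdπ : d ≤ π.direction) (heπ : e ≤ π.direction) :
    {l | l ∈ L ∧ l.direction = d ∧ ¬ l ≤ π}.encard +
      {l | l ∈ L ∧ l.direction = e ∧ l ≤ π}.encard = x := by
  rw [← hL.2 _ (isLineSpread_switchedClass hd he hdπ heπ), ← Set.encard_union_eq]
  · congr 1
    ext l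
    have := @hL.1 l
    simp only [switchedClass, Set.mem_union, Set.mem_inter_iff, Set.mem_ofPred_eq]
    tauto
  · exact Set.disjoint_left.2 fun l h h' => h.2.2 h'.2.2

/-- In every affine subspace, all directions carry the same number of lines of `L`. -/
lemma encard_le_eq (hL : IsCLLineClass L x) {d e : Submodule F V}
    {π : AffineSubspace F V} (hd : Module.finrank F d = 1) (he : Module.finrank F e = 1)
    (hdπ : d ≤ π.direction) (heπ : e ≤ π.direction) :
    {l | l ∈ L ∧ l.direction = e ∧ l ≤ π}.encard =
      {l | l ∈ L ∧ l.direction = d ∧ l ≤ π}.encard := by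
  have h1 := hL.encard_inter_switchedClass hd he hdπ heπ
  have h2 := hL.encard_inter_switchedClass hd hd hdπ hdπ
  have hfin : {l | l ∈ L ∧ l.direction = d ∧ ¬ l ≤ π}.encard ≠ ⊤ := fun h => by
    rw [h, top_add] at h2
    exact ENat.natCast_ne_top x h2.symm
  exact (WithTop.add_left_inj hfin).1 (h1.trans h2.symm)

lemma encard_direction_eq (hL : IsCLLineClass L x) {d : Submodule F V}
    (hd : Module.finrank F d = 1) : {l | l ∈ L ∧ l.direction = d}.encard = x := by
  rw [← hL.encard_inter_switchedClass (π := ⊤) hd hd (by simp) (by simp)]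
  simp

/-- Through some point of each line of `L` there is a line of `L` with any other direction. -/
lemma exists_meeting (hL : IsCLLineClass L x) {l : AffineSubspace F V} (hl : l ∈ L)
    {e : Submodule F V} (he : Module.finrank F e = 1) :
    ∃ m ∈ L, m.direction = e ∧ ∃ p, p ∈ l ∧ p ∈ m := by
  obtain ⟨⟨p, hp⟩, hd⟩ := hL.1 hl
  have hπ := AffineSubspace.direction_mk' p (l.direction ⊔ e)
  have h := hL.encard_le_eq (π := AffineSubspace.mk' p (l.direction ⊔ e)) hd he
    (by rw [hπ]; exact le_sup_left) (by rw [hπ]; exact le_sup_right)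
  have hne : {m | m ∈ L ∧ m.direction = l.direction ∧
      m ≤ AffineSubspace.mk' p (l.direction ⊔ e)}.encard ≠ 0 := by
    rw [Set.encard_ne_zero]
    exact ⟨l, hl, rfl, le_of_mem_of_direction_le hp (AffineSubspace.self_mem_mk' _ _)
      (by rw [hπ]; exact le_sup_left)⟩
  rw [← h, Set.encard_ne_zero] at hne
  obtain ⟨m, hm, hme, hmπ⟩ := hne
  refine ⟨m, hm, hme, ?_⟩
  obtain ⟨q, hq⟩ := (hL.1 hm).1
  have hqp := AffineSubspace.mem_mk'.1 (hmπ hq)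
  obtain ⟨u, hu, v, hv, huv⟩ := Submodule.mem_sup.1 hqp
  refine ⟨u +ᵥ p, AffineSubspace.vadd_mem_of_mem_direction hu hp, ?_⟩
  have : u +ᵥ p = -v +ᵥ q := by
    simp only [vadd_eq_add, vsub_eq_sub] at huv ⊢
    rw [eq_sub_iff_add_eq] at huv
    rw [← huv]; abel
  rw [this]
  exact AffineSubspace.vadd_mem_of_mem_direction (neg_mem (hme ▸ hv)) hq

lemma eq_of_direction_eq (hL : IsCLLineClass L 1) {l m : AffineSubspace F V} (hl : l ∈ L)
    (hm : m ∈ L) (h : l.direction = m.direction) : l = m := by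
  have h1 := hL.encard_direction_eq (hL.1 hm).2
  obtain ⟨k, hk⟩ := Set.encard_eq_one.1 (h1.trans Nat.cast_one)
  have hl' : l ∈ ({k} : Set _) := hk ▸ ⟨hl, h⟩
  have hm' : m ∈ ({k} : Set _) := hk ▸ ⟨hm, rfl⟩
  exact hl'.trans hm'.symm

lemma exists_mem_mem (hL : IsCLLineClass L 1) {l m : AffineSubspace F V} (hl : l ∈ L)
    (hm : m ∈ L) : ∃ p, p ∈ l ∧ p ∈ m := by
  obtain ⟨k, hk, hkm, hp⟩ := hL.exists_meeting hl (hL.1 hm).2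
  exact hL.eq_of_direction_eq hk hm hkm ▸ hp

lemma exists_mem_of_direction (hL : IsCLLineClass L x) (hx : x ≠ 0) {d : Submodule F V}
    (hd : Module.finrank F d = 1) : ∃ l ∈ L, l.direction = d := by
  have h : {l | l ∈ L ∧ l.direction = d}.encard ≠ 0 := by
    rw [hL.encard_direction_eq hd]; exact_mod_cast hx
  obtain ⟨l, hl⟩ := Set.encard_ne_zero.1 h
  exact ⟨l, hl⟩

end IsCLLineClass

lemma inf_eq_bot_of_not_le {d U : Submodule F V} (hd : Module.finrank F d = 1) (h : ¬ d ≤ U) :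
    d ⊓ U = ⊥ :=
  ((Submodule.isAtom_iff_finrank_eq_one.2 hd).not_le_iff_disjoint.1 h).eq_bot

lemma finrank_sup_of_not_le [FiniteDimensional F V] {d U : Submodule F V}
    (hd : Module.finrank F d = 1) (h : ¬ d ≤ U) :
    Module.finrank F ↥(d ⊔ U) = Module.finrank F U + 1 := by
  have := Submodule.finrank_sup_add_finrank_inf_eq d U
  rw [inf_eq_bot_of_not_le hd h, finrank_bot, hd] at this
  omega

lemma exists_direction_not_le [FiniteDimensional F V] {U : Submodule F V}
    (h : Module.finrank F U < Module.finrank F V) :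
    ∃ d : Submodule F V, Module.finrank F d = 1 ∧ ¬ d ≤ U := by
  have hU : U ≠ ⊤ := fun hU => by rw [hU, finrank_top] at h; exact h.false
  obtain ⟨v, -, hv⟩ := SetLike.exists_of_lt (lt_top_iff_ne_top.2 hU)
  refine ⟨F ∙ v, finrank_span_singleton ?_, fun hle => hv (hle (Submodule.mem_span_singleton_self v))⟩
  rintro rfl
  exact hv U.zero_mem

lemma exists_direction_le {U : Submodule F V} (h : U ≠ ⊥) :
    ∃ d : Submodule F V, Module.finrank F d = 1 ∧ d ≤ U := by
  obtain ⟨v, hv, hv0⟩ := Submodule.exists_mem_ne_zero_of_ne_bot h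
  exact ⟨F ∙ v, finrank_span_singleton hv0, (Submodule.span_singleton_le_iff_mem v U).2 hv⟩

lemma sub_mem_direction {l : AffineSubspace F V} {p q : V} (hp : p ∈ l) (hq : q ∈ l) :
    p - q ∈ l.direction :=
  AffineSubspace.vsub_mem_direction hp hq

lemma eq_of_mem_direction_of_not_le {d U : Submodule F V} (hd : Module.finrank F d = 1)
    (h : ¬ d ≤ U) {p q : V} (h1 : p - q ∈ d) (h2 : p - q ∈ U) : p = q := by
  have : p - q ∈ d ⊓ U := ⟨h1, h2⟩
  rwa [inf_eq_bot_of_not_le hd h, Submodule.mem_bot, sub_eq_zero] at this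

lemma isCLLineClass_pointPencil (p : V) : IsCLLineClass (pointPencil F p) 1 := by
  refine ⟨fun l hl => hl.1, fun S hS => ?_⟩
  obtain ⟨l, hl, hpl⟩ := hS.2 p
  rw [Nat.cast_one, Set.encard_eq_one]
  refine ⟨l, Set.eq_singleton_iff_unique_mem.2 ⟨⟨⟨hS.1.1 hl, hpl⟩, hl⟩, ?_⟩⟩
  rintro m ⟨⟨-, hpm⟩, hm⟩
  by_contra hne
  exact Set.disjoint_left.1 (hS.1.2 hm hl hne) hpm hpl

lemma isCLLineClass_zero_iff {L : Set (AffineSubspace F V)} : IsCLLineClass L 0 ↔ L = ∅ := by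
  refine ⟨fun hL => Set.eq_empty_of_forall_notMem fun l hl => ?_, ?_⟩
  · have h := hL.encard_direction_eq (hL.1 hl).2
    rw [Nat.cast_zero, Set.encard_eq_zero] at h
    exact (h ▸ (⟨hl, rfl⟩ : l ∈ {m | m ∈ L ∧ m.direction = l.direction}) : l ∈ (∅ : Set _))
  · rintro rfl
    exact ⟨Set.empty_subset _, fun S _ => by simp⟩

lemma IsCLLineClass.exists_eq_pointPencil (hV : 3 ≤ Module.finrank F V)
    {L : Set (AffineSubspace F V)} (hL : IsCLLineClass L 1) : ∃ p : V, L = pointPencil F p := by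
  have : FiniteDimensional F V := FiniteDimensional.of_finrank_pos (by omega)
  obtain ⟨d, hd, -⟩ := exists_direction_not_le (U := (⊥ : Submodule F V)) (by simp; omega)
  obtain ⟨e, he, hed⟩ := exists_direction_not_le (U := d) (by omega)
  have hde := finrank_sup_of_not_le he hed
  obtain ⟨g, hg, hgde⟩ := exists_direction_not_le (U := e ⊔ d) (by omega)
  obtain ⟨l, hl, rfl⟩ := hL.exists_mem_of_direction one_ne_zero hd
  obtain ⟨m, hm, rfl⟩ := hL.exists_mem_of_direction one_ne_zero he
  obtain ⟨n, hn, rfl⟩ := hL.exists_mem_of_direction one_ne_zero hg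
  obtain ⟨p, hpl, hpm⟩ := hL.exists_mem_mem hl hm
  have key : ∀ k ∈ L, ¬ k.direction ≤ m.direction ⊔ l.direction → p ∈ k := by
    intro k hk hkU
    obtain ⟨a, hak, hal⟩ := hL.exists_mem_mem hk hl
    obtain ⟨b, hbk, hbm⟩ := hL.exists_mem_mem hk hm
    have hap := Submodule.mem_sup_right (S := m.direction) (sub_mem_direction hal hpl)
    have hbp := Submodule.mem_sup_left (T := l.direction) (sub_mem_direction hbm hpm)
    obtain rfl : a = b := eq_of_mem_direction_of_not_le (hL.1 hk).2 hkU
      (sub_mem_direction hak hbk) (by simpa using sub_mem hap hbp)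
    obtain rfl : a = p := eq_of_mem_direction_of_not_le he hed
      (sub_mem_direction hbm hpm) (sub_mem_direction hal hpl)
    exact hak
  have hpn := key n hn hgde
  have hp : ∀ k ∈ L, p ∈ k := by
    intro k hk
    by_cases hkU : k.direction ≤ m.direction ⊔ l.direction
    · obtain ⟨a, hak, hal⟩ := hL.exists_mem_mem hk hl
      obtain ⟨c, hck, hcn⟩ := hL.exists_mem_mem hk hn
      have hap := Submodule.mem_sup_right (S := m.direction) (sub_mem_direction hal hpl)
      obtain rfl : c = p := eq_of_mem_direction_of_not_le hg hgde (sub_mem_direction hcn hpn)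
        (by simpa using add_mem (hkU (sub_mem_direction hck hak)) hap)
      exact hck
    · exact key k hk hkU
  refine ⟨p, Set.ext fun k => ⟨fun hk => ⟨hL.1 hk, hp k hk⟩, fun hk => ?_⟩⟩
  obtain ⟨k', hk', h⟩ := hL.exists_mem_of_direction one_ne_zero hk.1.2
  rwa [← eq_of_mem_of_direction_eq (hp k' hk') hk.2 h]

lemma IsCLLineClass.exists_pair [FiniteDimensional F V] {L : Set (AffineSubspace F V)}
    (hL : IsCLLineClass L 2) {d : Submodule F V} (hd : Module.finrank F d = 1) :
    ∃ (l m : AffineSubspace F V) (p q : V), {k | k ∈ L ∧ k.direction = d} = {l, m} ∧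
      p ∈ l ∧ q ∈ m ∧ Module.finrank F ↥((F ∙ (q - p)) ⊔ d) = 2 := by
  obtain ⟨l, m, hlm, hpair⟩ := Set.encard_eq_two.1 (hL.encard_direction_eq hd)
  obtain ⟨hl, hld⟩ : l ∈ {k | k ∈ L ∧ k.direction = d} := hpair ▸ Set.mem_insert _ _
  obtain ⟨hm, hmd⟩ : m ∈ {k | k ∈ L ∧ k.direction = d} := hpair ▸ Set.mem_insert_of_mem _ rfl
  obtain ⟨p, hp⟩ := (hL.1 hl).1
  obtain ⟨q, hq⟩ := (hL.1 hm).1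
  have hqp : q - p ∉ d := fun h => hlm <| by
    have := AffineSubspace.vadd_mem_of_mem_direction (hld ▸ h) hp
    exact eq_of_mem_of_direction_eq (p := q) (by simpa using this) hq (hld.trans hmd.symm)
  have hv : Module.finrank F (F ∙ (q - p)) = 1 :=
    finrank_span_singleton fun h => hqp (h ▸ d.zero_mem)
  refine ⟨l, m, p, q, hpair, hp, hq, ?_⟩
  rw [finrank_sup_of_not_le hv fun h => hqp (h (Submodule.mem_span_singleton_self _)), hd]

/-- The two lines of `L` with direction `d` span a plane, which contains all lines of `L` that are
parallel to it. -/
lemma IsCLLineClass.exists_plane [FiniteDimensional F V] {L : Set (AffineSubspace F V)}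
    (hL : IsCLLineClass L 2) {d : Submodule F V} (hd : Module.finrank F d = 1) :
    ∃ π : AffineSubspace F V, Module.finrank F π.direction = 2 ∧ d ≤ π.direction ∧
      ∀ l ∈ L, l.direction ≤ π.direction → l ≤ π := by
  obtain ⟨l, m, p, q, hpair, hp, hq, hU⟩ := hL.exists_pair hd
  obtain ⟨hl, hld⟩ : l ∈ {k | k ∈ L ∧ k.direction = d} := hpair ▸ Set.mem_insert _ _
  obtain ⟨hm, hmd⟩ : m ∈ {k | k ∈ L ∧ k.direction = d} := hpair ▸ Set.mem_insert_of_mem _ rfl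
  have hπ := AffineSubspace.direction_mk' p ((F ∙ (q - p)) ⊔ d)
  have hdπ : d ≤ (AffineSubspace.mk' p ((F ∙ (q - p)) ⊔ d)).direction := by
    rw [hπ]; exact le_sup_right
  refine ⟨AffineSubspace.mk' p ((F ∙ (q - p)) ⊔ d), by rw [hπ, hU], hdπ, fun k hk hkU => ?_⟩
  have hall : {k | k ∈ L ∧ k.direction = d ∧ k ≤ AffineSubspace.mk' p ((F ∙ (q - p)) ⊔ d)} =
      {k | k ∈ L ∧ k.direction = d} := by
    refine Set.Subset.antisymm (fun k hk => ⟨hk.1, hk.2.1⟩) fun k hk => ⟨hk.1, hk.2, ?_⟩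
    rw [hpair] at hk
    obtain rfl | rfl := hk
    · exact le_of_mem_of_direction_le hp (AffineSubspace.self_mem_mk' _ _) (hld.trans_le hdπ)
    · exact le_of_mem_of_direction_le hq (AffineSubspace.mem_mk'.2
        (Submodule.mem_sup_left (Submodule.mem_span_singleton_self _))) (hmd.trans_le hdπ)
  have hk1 := (hL.1 hk).2
  have hcard := hL.encard_le_eq hd hk1 hdπ hkU
  rw [hall, hL.encard_direction_eq hd, ← hL.encard_direction_eq hk1] at hcard
  have hfin : {m | m ∈ L ∧ m.direction = k.direction}.Finite :=
    Set.finite_of_encard_eq_coe (hL.encard_direction_eq hk1)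
  have hsub : {m | m ∈ L ∧ m.direction = k.direction ∧
      m ≤ AffineSubspace.mk' p ((F ∙ (q - p)) ⊔ d)} ⊆ {m | m ∈ L ∧ m.direction = k.direction} :=
    fun m hm => ⟨hm.1, hm.2.1⟩
  have heq := (hfin.subset hsub).eq_of_subset_of_encard_le hsub hcard.ge
  have hmem : k ∈ {m | m ∈ L ∧ m.direction = k.direction} := ⟨hk, rfl⟩
  rw [← heq] at hmem
  exact hmem.2.2

lemma not_isCLLineClass_two (hV : Module.finrank F V = 3) (L : Set (AffineSubspace F V)) :
    ¬ IsCLLineClass L 2 := by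
  intro hL
  have : FiniteDimensional F V := FiniteDimensional.of_finrank_pos (by omega)
  obtain ⟨d, hd, -⟩ := exists_direction_not_le (U := (⊥ : Submodule F V)) (by simp; omega)
  obtain ⟨π, hπ, -, hπL⟩ := hL.exists_plane hd
  obtain ⟨g, hg, hgπ⟩ := exists_direction_not_le (U := π.direction) (by omega)
  obtain ⟨ρ, hρ, hgρ, hρL⟩ := hL.exists_plane hg
  have hdim := Submodule.finrank_sup_add_finrank_inf_eq π.direction ρ.direction
  have hle := Submodule.finrank_le (π.direction ⊔ ρ.direction)
  obtain ⟨e, he, heπρ⟩ := exists_direction_le (U := π.direction ⊓ ρ.direction) fun h => by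
    rw [h, finrank_bot] at hdim; omega
  obtain ⟨heπ, heρ⟩ := le_inf_iff.1 heπρ
  obtain ⟨l, m, p, q, hpair, hp, hq, hU⟩ := hL.exists_pair he
  obtain ⟨hl, hle⟩ : l ∈ {k | k ∈ L ∧ k.direction = e} := hpair ▸ Set.mem_insert _ _
  obtain ⟨hm, hme⟩ : m ∈ {k | k ∈ L ∧ k.direction = e} := hpair ▸ Set.mem_insert_of_mem _ rfl
  have hspan : ∀ σ : AffineSubspace F V, Module.finrank F σ.direction = 2 → e ≤ σ.direction →
      (∀ l ∈ L, l.direction ≤ σ.direction → l ≤ σ) → (F ∙ (q - p)) ⊔ e = σ.direction := by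
    intro σ hσ heσ hσL
    refine Submodule.eq_of_le_of_finrank_eq (sup_le ?_ heσ) (by omega)
    rw [Submodule.span_singleton_le_iff_mem]
    exact sub_mem_direction (hσL m hm (hme.trans_le heσ) hq) (hσL l hl (hle.trans_le heσ) hp)
  exact hgπ (hgρ.trans_eq ((hspan ρ hρ heρ hρL).symm.trans (hspan π hπ heπ hπL)))

end

end AffineCL

theorem corollary4p5 (F : Type*) [Field F] [Finite F]
    (V : Type*) [AddCommGroup V] [Module F V] (hV : Module.finrank F V = 3) :
    (∀ L : Set (AffineSubspace F V), AffineCL.IsCLLineClass L 0 ↔ L = ∅) ∧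
    (∀ L : Set (AffineSubspace F V),
      AffineCL.IsCLLineClass L 1 ↔ ∃ p : V, L = AffineCL.pointPencil F p) ∧
    (¬ ∃ L : Set (AffineSubspace F V), AffineCL.IsCLLineClass L 2) := by
  refine ⟨fun L => AffineCL.isCLLineClass_zero_iff,
    fun L => ⟨fun hL => hL.exists_eq_pointPencil hV.ge, ?_⟩,
    fun ⟨L, hL⟩ => AffineCL.not_isCLLineClass_two hV L hL⟩
  rintro ⟨p, rfl⟩
  exact AffineCL.isCLLineClass_pointPencil p
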